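/- For positive integers $k \ge 2d$, a $(k,d)$-coloring of a graph $G$ is a map $f : V(G) \to \{0,1,\dots,k-1\}$ such that $d \le |f(x)-f(y)| \le k-d$ for every edge $xy$ of $G$. The circular chromatic number of $G$ is $\chi_c(G) = \inf\{k/d : G \text{ has a } (k,d)\text{-coloring}\}$. Let $P_L$ be the line graph of the Petersen graph. Then $\chi_c(P_L) = 11/3$. -/

import Mathlib

/-- The Petersen graph: its vertices are the ten 2-element subsets of a 5-element set, and two of
them are adjacent when they are disjoint. -/
def petersenGraph : SimpleGraph {s : Finset (Fin 5) // s.card = 2} where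
  Adj s t := Disjoint s.1 t.1
  symm := ⟨fun _ _ h => Disjoint.symm h⟩
  loopless := ⟨fun s h => by
    have h0 : s.1 = ∅ := Finset.disjoint_self_iff_empty _ |>.mp h
    have h2 := s.2
    simp [h0] at h2⟩

/-- `f` is a `(k, d)`-coloring of `G`: it maps the vertices to `{0, 1, …, k - 1}`, and the values at
the ends `x`, `y` of any edge satisfy `d ≤ |f x - f y| ≤ k - d` (computed in the integers). -/
def IsCircularColoring {V : Type*} (G : SimpleGraph V) (k d : ℕ) (f : V → Fin k) : Prop :=
  ∀ x y : V, G.Adj x y →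
    (d : ℤ) ≤ |((f x : ℕ) : ℤ) - ((f y : ℕ) : ℤ)| ∧
      |((f x : ℕ) : ℤ) - ((f y : ℕ) : ℤ)| ≤ (k : ℤ) - (d : ℤ)

/-- The circular chromatic number of `G`: the infimum of `k / d` over all positive integers `k`, `d`
with `k ≥ 2 d` such that `G` has a `(k, d)`-coloring. -/
noncomputable def circularChromaticNumber {V : Type*} (G : SimpleGraph V) : ℝ :=
  sInf {r : ℝ | ∃ k d : ℕ, 0 < d ∧ 2 * d ≤ k ∧ (∃ f : V → Fin k, IsCircularColoring G k d f) ∧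
    r = (k : ℝ) / (d : ℝ)}

/-! ### The line graph of the Petersen graph -/

/-! The upper bound is an explicit `(11, 3)`-coloring, `petersenColor`. For the lower bound, suppose
`k / d < 11 / 3`. Scaling colors by `11 / k` and rounding down gives an `(11, 3)`-coloring, and the
remainder strictly increases along each tight step, one that adds exactly `3` modulo `11`
(`IsCircularColoring.exists_discretization`). So no closed walk can consist of tight steps only. Yet
a finite search, `everyColoringHasTightWalk_eq_true`, finds one in every candidate coloring. -/

/-- The ends of the fifteen edges of the Petersen graph. -/
def petersenEnds : Fin 15 →
    {s : Finset (Fin 5) // s.card = 2} × {s : Finset (Fin 5) // s.card = 2} :=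
  ![(⟨{0, 1}, rfl⟩, ⟨{2, 3}, rfl⟩), (⟨{1, 4}, rfl⟩, ⟨{2, 3}, rfl⟩),
    (⟨{0, 1}, rfl⟩, ⟨{3, 4}, rfl⟩), (⟨{0, 1}, rfl⟩, ⟨{2, 4}, rfl⟩),
    (⟨{0, 4}, rfl⟩, ⟨{2, 3}, rfl⟩), (⟨{0, 2}, rfl⟩, ⟨{3, 4}, rfl⟩),
    (⟨{0, 2}, rfl⟩, ⟨{1, 4}, rfl⟩), (⟨{0, 2}, rfl⟩, ⟨{1, 3}, rfl⟩),
    (⟨{0, 4}, rfl⟩, ⟨{1, 3}, rfl⟩), (⟨{1, 3}, rfl⟩, ⟨{2, 4}, rfl⟩),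
    (⟨{0, 4}, rfl⟩, ⟨{1, 2}, rfl⟩), (⟨{1, 2}, rfl⟩, ⟨{3, 4}, rfl⟩),
    (⟨{0, 3}, rfl⟩, ⟨{1, 4}, rfl⟩), (⟨{0, 3}, rfl⟩, ⟨{2, 4}, rfl⟩),
    (⟨{0, 3}, rfl⟩, ⟨{1, 2}, rfl⟩)]

instance : DecidableRel petersenGraph.Adj := fun s t =>
  inferInstanceAs (Decidable (Disjoint s.1 t.1))

theorem petersenEnds_adj :
    ∀ i, petersenGraph.Adj (petersenEnds i).1 (petersenEnds i).2 := by
  decide +kernel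

/-- The fifteen edges of the Petersen graph. -/
def petersenEdge (i : Fin 15) : petersenGraph.edgeSet :=
  ⟨s((petersenEnds i).1, (petersenEnds i).2), petersenEnds_adj i⟩

theorem petersenEnds_surjective : ∀ s t, petersenGraph.Adj s t → ∃ i,
    (s = (petersenEnds i).1 ∧ t = (petersenEnds i).2) ∨
      (s = (petersenEnds i).2 ∧ t = (petersenEnds i).1) := by
  decide +kernel

theorem petersenEdge_surjective : Function.Surjective petersenEdge := by
  rintro ⟨e, he⟩
  induction e using Sym2.ind with
  | _ s t =>
    obtain ⟨i, hi⟩ := petersenEnds_surjective s t he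
    exact ⟨i, Subtype.ext (Sym2.eq_iff.2 (by tauto))⟩

/-- For each edge of the Petersen graph, the edges that share an end with it. -/
def petersenNeighbors : Fin 15 → List (Fin 15) :=
  ![[1, 2, 3, 4], [0, 4, 6, 12], [0, 3, 5, 11], [0, 2, 9, 13], [0, 1, 8, 10], [2, 6, 7, 11],
    [1, 5, 7, 12], [5, 6, 8, 9], [4, 7, 9, 10], [3, 7, 8, 13], [4, 8, 11, 14], [2, 5, 10, 14],
    [1, 6, 13, 14], [3, 9, 12, 14], [10, 11, 12, 13]]

theorem mem_petersenNeighbors : ∀ i j, j ∈ petersenNeighbors i ↔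
    (¬(((petersenEnds i).1 = (petersenEnds j).1 ∧ (petersenEnds i).2 = (petersenEnds j).2) ∨
      ((petersenEnds i).1 = (petersenEnds j).2 ∧ (petersenEnds i).2 = (petersenEnds j).1))) ∧
    (((petersenEnds i).1 = (petersenEnds j).1 ∨ (petersenEnds i).1 = (petersenEnds j).2) ∨
      ((petersenEnds i).2 = (petersenEnds j).1 ∨ (petersenEnds i).2 = (petersenEnds j).2)) := by
  decide +kernel

theorem lineGraph_petersenGraph_adj (i j : Fin 15) :
    petersenGraph.lineGraph.Adj (petersenEdge i) (petersenEdge j) ↔ j ∈ petersenNeighbors i := by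
  rw [mem_petersenNeighbors, SimpleGraph.lineGraph_adj_iff_exists]
  refine and_congr (not_congr (Subtype.ext_iff.trans Sym2.eq_iff)) ?_
  simp only [petersenEdge, Sym2.mem_iff, or_and_right, exists_or, exists_eq_left]

/-- An `(11, 3)`-coloring of the edges of the Petersen graph. -/
def petersenColor : Fin 15 → Fin 11 :=
  ![0, 3, 4, 7, 6, 8, 0, 5, 2, 10, 9, 1, 8, 2, 5]

theorem petersenColor_spec : ∀ i, ∀ j ∈ petersenNeighbors i,
    (3 : ℤ) ≤ |((petersenColor i : ℕ) : ℤ) - ((petersenColor j : ℕ) : ℤ)| ∧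
      |((petersenColor i : ℕ) : ℤ) - ((petersenColor j : ℕ) : ℤ)| ≤ 8 := by
  decide +kernel

theorem exists_isCircularColoring_eleven_three :
    ∃ f : petersenGraph.edgeSet → Fin 11, IsCircularColoring petersenGraph.lineGraph 11 3 f := by
  refine ⟨fun e => petersenColor (Function.surjInv petersenEdge_surjective e), fun x y h => ?_⟩
  have hx := Function.surjInv_eq petersenEdge_surjective x
  have hy := Function.surjInv_eq petersenEdge_surjective y
  rw [← hx, ← hy, lineGraph_petersenGraph_adj] at h
  have := petersenColor_spec _ _ h
  norm_num
  exact this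

/-! ### Discretizing a circular coloring of ratio less than `11 / 3` -/

/-- A `(k, d)`-coloring with `k / d < 11 / 3` can be rotated so that a given vertex `v` gets color
`0` and then rounded down to an `(11, 3)`-coloring `g`; the remainders `t` increase along every
pair of adjacent vertices whose colors differ by exactly `3` modulo `11`. -/
theorem IsCircularColoring.exists_discretization {V : Type*} {G : SimpleGraph V} {k d : ℕ}
    {f : V → Fin k} (hf : IsCircularColoring G k d f) (hkd : 3 * k < 11 * d) (v : V) :
    ∃ g t : V → ℕ, g v = 0 ∧ t v = 0 ∧ (∀ x, g x < 11) ∧ ∀ x y, G.Adj x y →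
      ((g x + 3 ≤ g y ∧ g y ≤ g x + 8) ∨ (g y + 3 ≤ g x ∧ g x ≤ g y + 8)) ∧
      (g y = g x + 3 ∨ g x = g y + 8 → t x < t y) := by
  have hk : 0 < k := (f v).pos
  -- `D x` is the residue of `f x - f v` modulo `k`; this rotation preserves circular distances.
  obtain ⟨D, hD⟩ : ∃ D : V → ℕ, ∀ x, D x < k ∧
      (D x + (f v : ℕ) = f x ∨ D x + (f v : ℕ) = f x + k) := by
    refine ⟨fun x => if (f v : ℕ) ≤ f x then f x - f v else f x + k - f v, fun x => ?_⟩
    have := (f x).isLt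
    have := (f v).isLt
    dsimp only
    split_ifs <;> omega
  have hv : D v = 0 := by
    have := hD v
    omega
  have hdist : ∀ x y, G.Adj x y →
      (D x + d ≤ D y ∧ D y + d ≤ D x + k) ∨ (D y + d ≤ D x ∧ D x + d ≤ D y + k) := by
    intro x y h
    have h1 := hf x y h
    have := hD x
    have := hD y
    have := (f x).isLt
    have := (f y).isLt
    rcases abs_cases (((f x : ℕ) : ℤ) - ((f y : ℕ) : ℤ)) with h2 | h2 <;>
    · rw [h2.1] at h1
      omega
  -- Both arcs between `a` and `b` have length at least `d`, so the hypothesis `3 * k < 11 * d`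
  -- gives `3 * k < 11 * (b - a) < 8 * k`. If the quotients differ by exactly `3` or `8`, the
  -- strictness passes to the remainders.
  have key : ∀ a b, a + d ≤ b → b + d ≤ a + k →
      (11 * a / k + 3 ≤ 11 * b / k ∧ 11 * b / k ≤ 11 * a / k + 8) ∧
      (11 * b / k = 11 * a / k + 3 → 11 * a % k < 11 * b % k) ∧
      (11 * b / k = 11 * a / k + 8 → 11 * b % k < 11 * a % k) := by
    intro a b h1 h2
    have ha := Nat.div_add_mod (11 * a) k
    have hb := Nat.div_add_mod (11 * b) k
    have ha' := Nat.mod_lt (11 * a) hk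
    have hb' := Nat.mod_lt (11 * b) hk
    generalize 11 * a / k = p at *
    generalize 11 * b / k = q at *
    generalize 11 * a % k = s at *
    generalize 11 * b % k = u at *
    refine ⟨⟨?_, ?_⟩, ?_, ?_⟩
    · by_contra! h
      have := Nat.mul_le_mul_left k (show q ≤ p + 2 by omega)
      rw [mul_add] at this
      omega
    · by_contra! h
      have := Nat.mul_le_mul_left k (show p + 9 ≤ q by omega)
      rw [mul_add] at this
      omega
    · rintro rfl
      rw [mul_add] at hb
      omega
    · rintro rfl
      rw [mul_add] at hb
      omega
  refine ⟨fun x => 11 * D x / k, fun x => 11 * D x % k, by simp [hv], by simp [hv],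
    fun x => ?_, fun x y h => ?_⟩
  · rw [Nat.div_lt_iff_lt_mul hk]
    have := hD x
    omega
  · dsimp only
    rcases hdist x y h with h | h
    · have := key _ _ h.1 h.2
      omega
    · have := key _ _ h.1 h.2
      omega

/-! ### Exhaustive search for colorings without tight cycles -/

/-- The set of colors at distance between `3` and `8` from the color `c < 11`, as a bit mask. -/
def apartMask : ℕ → ℕ
  | 0 => 504 | 1 => 1008 | 2 => 2016 | 3 => 1985 | 4 => 1923 | 5 => 1799 | 6 => 1551 | 7 => 1055
  | 8 => 63 | 9 => 126 | _ => 252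

theorem testBit_apartMask : ∀ a < 11, ∀ c < 11,
    (a + 3 ≤ c ∧ c ≤ a + 8) ∨ (c + 3 ≤ a ∧ a ≤ c + 8) → (apartMask a).testBit c = true := by
  decide +kernel

/-- The predicate `p` holds for every color `c < 11` in the bit mask `m`; it is given the mask
`apartMask c` as a second argument. -/
def forallColor (m : ℕ) (p : ℕ → ℕ → Bool) : Bool :=
  (Nat.beq (m.land 1) 0 || p 0 504) && (Nat.beq (m.land 2) 0 || p 1 1008) &&
  (Nat.beq (m.land 4) 0 || p 2 2016) && (Nat.beq (m.land 8) 0 || p 3 1985) &&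
  (Nat.beq (m.land 16) 0 || p 4 1923) && (Nat.beq (m.land 32) 0 || p 5 1799) &&
  (Nat.beq (m.land 64) 0 || p 6 1551) && (Nat.beq (m.land 128) 0 || p 7 1055) &&
  (Nat.beq (m.land 256) 0 || p 8 63) && (Nat.beq (m.land 512) 0 || p 9 126) &&
  (Nat.beq (m.land 1024) 0 || p 10 252)

theorem forallColor_spec {m : ℕ} {p : ℕ → ℕ → Bool} (h : forallColor m p = true) {c : ℕ}
    (hc : c < 11) (hm : m.testBit c = true) : p c (apartMask c) = true := by
  have hne : Nat.beq (m.land (2 ^ c)) 0 = false := by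
    refine Bool.eq_false_iff.2 fun h0 => ?_
    have h1 : (m &&& 2 ^ c).testBit c = false := by
      rw [show m &&& 2 ^ c = 0 from Nat.eq_of_beq_eq_true h0, Nat.zero_testBit]
    simp [Nat.testBit_and, hm] at h1
  simp only [forallColor, Bool.and_eq_true] at h
  obtain ⟨⟨⟨⟨⟨⟨⟨⟨⟨⟨h0, h1⟩, h2⟩, h3⟩, h4⟩, h5⟩, h6⟩, h7⟩, h8⟩, h9⟩, h10⟩ := h
  interval_cases c <;> norm_num only at hne <;> simp_all only [Bool.false_or, apartMask]

/-- The color `b` is the color `a` plus `3`, modulo `11`. -/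
def IsTight (a b : ℕ) : Prop := b = a + 3 ∨ a = b + 8

instance : DecidableRel IsTight := fun a b =>
  inferInstanceAs (Decidable (b = a + 3 ∨ a = b + 8))

/-- Eight closed walks in the line graph of the Petersen graph. -/
def petersenWalks : List (List (Fin 15)) :=
  -- A closed walk of tight steps has length divisible by `11`, because `3` is invertible modulo
  -- `11`; each of these has exactly `11` steps.
  [[1, 4, 10, 11, 2, 3, 9, 13, 14, 12, 6, 1], [1, 4, 8, 9, 3, 2, 11, 5, 7, 6, 12, 1],
   [1, 4, 8, 10, 14, 11, 5, 2, 3, 13, 12, 1], [1, 4, 10, 8, 7, 9, 13, 3, 2, 5, 6, 1],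
   [1, 6, 5, 2, 3, 13, 12, 14, 11, 10, 4, 1], [1, 12, 13, 3, 2, 5, 6, 7, 9, 8, 4, 1],
   [1, 12, 6, 7, 5, 11, 2, 3, 9, 8, 4, 1], [1, 6, 5, 7, 8, 9, 3, 2, 11, 10, 4, 1]]

/-- One of the walks in `petersenWalks` is tight for the coloring `c`. -/
def hasTightWalk (c : Fin 15 → ℕ) : Bool :=
  decide (∃ w ∈ petersenWalks, w.IsChain fun i j => IsTight (c i) (c j))

/-- In each coloring that gives the color `0` to the first edge of the Petersen graph and colors
between `3` and `7` to its neighbors, there is a tight walk. -/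
def everyColoringHasTightWalk : Bool :=
  -- The mask `248` is the set of colors `3` to `7`. Each later edge is restricted by all its
  -- neighbors of smaller index.
  forallColor 248 fun c1 m1 =>
  forallColor 248 fun c2 m2 =>
  forallColor (.land 248 m2) fun c3 m3 =>
  forallColor (.land 248 m1) fun c4 m4 =>
  forallColor m2 fun c5 m5 =>
  forallColor (.land m1 m5) fun c6 m6 =>
  forallColor (.land m5 m6) fun c7 m7 =>
  forallColor (.land m4 m7) fun c8 m8 =>
  forallColor (.land m3 (.land m7 m8)) fun c9 m9 =>
  forallColor (.land m4 m8) fun c10 m10 =>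
  forallColor (.land m2 (.land m5 m10)) fun c11 m11 =>
  forallColor (.land m1 m6) fun c12 m12 =>
  forallColor (.land m3 (.land m9 m12)) fun c13 m13 =>
  forallColor (.land (.land m10 m11) (.land m12 m13)) fun c14 _ =>
  hasTightWalk ![0, c1, c2, c3, c4, c5, c6, c7, c8, c9, c10, c11, c12, c13, c14]

theorem everyColoringHasTightWalk_eq_true : everyColoringHasTightWalk = true := by
  decide +kernel

theorem eleven_mul_le_of_isCircularColoring {k d : ℕ} {f : petersenGraph.edgeSet → Fin k}
    (hf : IsCircularColoring petersenGraph.lineGraph k d f) : 11 * d ≤ 3 * k := by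
  by_contra! hkd
  obtain ⟨g, t, hg0, ht0, hlt, h⟩ := hf.exists_discretization hkd (petersenEdge 0)
  obtain ⟨c, hc⟩ : ∃ c : Fin 15 → ℕ, ∀ i, c i = g (petersenEdge i) := ⟨_, fun _ => rfl⟩
  have lt : ∀ i, c i < 11 := fun i => hc i ▸ hlt _
  have bit : ∀ i j, j ∈ petersenNeighbors i → (apartMask (c i)).testBit (c j) = true := by
    intro i j hij
    refine testBit_apartMask _ (lt i) _ (lt j) ?_
    rw [hc, hc]
    exact (h _ _ ((lineGraph_petersenGraph_adj i j).2 hij)).1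
  have bit0 : ∀ j ∈ petersenNeighbors 0, Nat.testBit 248 (c j) = true := by
    intro j hj
    have h1 := h _ _ ((lineGraph_petersenGraph_adj 0 j).2 hj)
    have h2 := h _ _ ((lineGraph_petersenGraph_adj 0 j).2 hj).symm
    rw [← hc, ← hc] at h1 h2
    rw [← hc] at hg0
    have hge : 3 ≤ c j := by omega
    -- Color `8` is excluded: the step from `j` back to edge `0` would be tight, forcing a remainder
    -- below `t (petersenEdge 0) = 0`.
    have hle : c j ≤ 7 := by omega
    interval_cases c j <;> rfl
  have tight : ∀ i j, j ∈ petersenNeighbors i → IsTight (c i) (c j) →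
      t (petersenEdge i) < t (petersenEdge j) := by
    intro i j hij
    rw [hc, hc]
    exact (h _ _ ((lineGraph_petersenGraph_adj i j).2 hij)).2
  have land : ∀ {a b i : ℕ}, a.testBit i = true → b.testBit i = true →
      (a.land b).testBit i = true := by
    intro a b i ha hb
    exact (Nat.testBit_and a b i).trans (by rw [ha, hb]; rfl)
  have walk : hasTightWalk c = true := by
    have hvec : c = ![0, c 1, c 2, c 3, c 4, c 5, c 6, c 7, c 8, c 9, c 10, c 11, c 12, c 13,
        c 14] := by
      funext i
      fin_cases i
      · exact (hc 0).trans hg0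
      all_goals rfl
    rw [hvec]
    have h0 := everyColoringHasTightWalk_eq_true
    have h1 := forallColor_spec h0 (lt 1) (bit0 1 (by decide))
    have h2 := forallColor_spec h1 (lt 2) (bit0 2 (by decide))
    have h3 := forallColor_spec h2 (lt 3) (land (bit0 3 (by decide)) (bit 2 3 (by decide)))
    have h4 := forallColor_spec h3 (lt 4) (land (bit0 4 (by decide)) (bit 1 4 (by decide)))
    have h5 := forallColor_spec h4 (lt 5) (bit 2 5 (by decide))
    have h6 := forallColor_spec h5 (lt 6) (land (bit 1 6 (by decide)) (bit 5 6 (by decide)))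
    have h7 := forallColor_spec h6 (lt 7) (land (bit 5 7 (by decide)) (bit 6 7 (by decide)))
    have h8 := forallColor_spec h7 (lt 8) (land (bit 4 8 (by decide)) (bit 7 8 (by decide)))
    have h9 := forallColor_spec h8 (lt 9)
      (land (bit 3 9 (by decide)) (land (bit 7 9 (by decide)) (bit 8 9 (by decide))))
    have h10 := forallColor_spec h9 (lt 10) (land (bit 4 10 (by decide)) (bit 8 10 (by decide)))
    have h11 := forallColor_spec h10 (lt 11)
      (land (bit 2 11 (by decide)) (land (bit 5 11 (by decide)) (bit 10 11 (by decide))))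
    have h12 := forallColor_spec h11 (lt 12) (land (bit 1 12 (by decide)) (bit 6 12 (by decide)))
    have h13 := forallColor_spec h12 (lt 13)
      (land (bit 3 13 (by decide)) (land (bit 9 13 (by decide)) (bit 12 13 (by decide))))
    exact forallColor_spec h13 (lt 14)
      (land (land (bit 10 14 (by decide)) (bit 11 14 (by decide)))
        (land (bit 12 14 (by decide)) (bit 13 14 (by decide))))
  suffices ¬∃ w ∈ petersenWalks, w.IsChain fun i j => IsTight (c i) (c j) from
    this (of_decide_eq_true walk)
  simp only [petersenWalks, List.exists_mem_cons_iff,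
    List.isChain_cons_cons, List.isChain_singleton, List.not_mem_nil, false_and, exists_false,
    and_true, or_false]
  rintro (h | h | h | h | h | h | h | h) <;>
  · obtain ⟨h1, h2, h3, h4, h5, h6, h7, h8, h9, h10, h11⟩ := h
    -- Around the closed walk, `t (petersenEdge 1)` would be less than itself.
    exact lt_irrefl _ <| (tight _ _ (by decide) h1).trans <| (tight _ _ (by decide) h2).trans <|
      (tight _ _ (by decide) h3).trans <| (tight _ _ (by decide) h4).trans <|
      (tight _ _ (by decide) h5).trans <| (tight _ _ (by decide) h6).trans <|
      (tight _ _ (by decide) h7).trans <| (tight _ _ (by decide) h8).trans <|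
      (tight _ _ (by decide) h9).trans <| (tight _ _ (by decide) h10).trans <|
      tight _ _ (by decide) h11

theorem mainTheorem6 : circularChromaticNumber petersenGraph.lineGraph = 11 / 3 := by
  refine IsLeast.csInf_eq ⟨⟨11, 3, by norm_num, by norm_num,
    exists_isCircularColoring_eleven_three, by norm_num⟩, ?_⟩
  rintro r ⟨k, d, hd, -, ⟨f, hf⟩, rfl⟩
  have h := eleven_mul_le_of_isCircularColoring hf
  rw [div_le_div_iff₀ (by norm_num) (by exact_mod_cast hd), mul_comm (k : ℝ)]
  exact_mod_cast h
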